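/- Theorem 1. Fix $a_1,a_2>0$ and a threshold $\tau\in\mathbb R$. Let $\mathcal D$ be the set of Gaussian distributions on $\mathbb R^2$ with arbitrary mean and covariance matrix $\mathrm{diag}\big(\tfrac1{2a_1},\tfrac1{2a_2}\big)$. A two-armed instance is a pair $\nu=(\nu(1),\nu(2))$ with $\nu(1),\nu(2)\in\mathcal D$. Write $\mu_1(i)$ and $\mu_2(i)$ for the mean of the first and of the second coordinate of $\nu(i)$ (the objective and the constraint attribute). Arm $i$ is feasible if $\mu_2(i)\le\tau$, and $\nu$ is feasible if some arm is feasible. In a feasible instance an arm is optimal if it minimises $\mu_1$ among the feasible arms; in an infeasible instance an arm is optimal if it minimises $\mu_2$. Instances are assumed to have a unique optimal arm, denoted $J(\nu)$; let $F(\nu)\in\{\mathrm{True},\mathrm{False}\}$ say whether $\nu$ is feasible. For each budget $T$, an algorithm (possibly randomised) chooses in each of $T$ rounds an arm on the basis of the past rounds and observes an independent sample of that arm, and after $T$ rounds outputs an arm $\hat J$ and a flag $\hat F\in\{\mathrm{True},\mathrm{False}\}$. Its probability of error on $\nu$ is $e_T(\nu)=\mathbb P_\nu\big(\hat J\ne J(\nu)\text{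 or }\hat F\ne F(\nu)\big)$. The algorithm is consistent if $e_T(\nu)\to0$ as $T\to\infty$ for every two-armed instance $\nu$ with arms in $\mathcal D$ and with a unique optimal arm. Let $\nu$ be a two-armed instance with arms in $\mathcal D$ and with a unique optimal arm $i$, and let $j$ be the other arm. Put $$\delta(i,j)=\begin{cases}\sqrt{a_1}\,(\mu_1(j)-\mu_1(i)) & \text{if } \mu_2(i)\le\tau,\ \mu_2(j)\le\tau,\\ \sqrt{a_2}\,(\mu_2(j)-\tau) & \text{if } \mu_2(i)\le\tau<\mu_2(j),\ \mu_1(j)\le\mu_1(i),\\ \max\{\sqrt{a_2}\,(\mu_2(j)-\tau),\ \sqrt{a_1}\,(\mu_1(j)-\mu_1(i))\} & \text{if } \mu_2(i)\le\tau<\mu_2(j),\ \mu_1(j)>\mu_1(i),\\ \sqrt{a_2}\,(\mu_2(j)-\mu_2(i)) & \text{if } \mu_2(i)>\tau,\ \mu_2(j)>\tau,\end{cases}$$ $$\Delta(i,j)=\min\{\sqrt{a_2}\,|\tau-\mu_2(i)|,\ \delta(i,j)\}.$$ Then every consistent algorithm satisfies $$\limsup_{T\to\infty}-\frac1T\log e_T(\nu)\le\Delta(i,j)^2,$$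 where $-\log 0=+\infty$. -/

import Mathlib

open MeasureTheory ProbabilityTheory Filter
open scoped ENNReal Topology

namespace ConstrainedBandit

noncomputable section

/-- A sample of an arm is a point of the plane. -/
abbrev Obs : Type := EuclideanSpace ℝ (Fin 2)

/-- A bandit with `K` arms: one probability distribution on the plane for each arm. -/
abbrev Bandit (K : ℕ) : Type := Fin K → ProbabilityMeasure Obs

/-- The attributes of an arm distribution: `attr G 0` (the objective attribute `μ₁`) is the mean of
the first coordinate and `attr G 1` (the constraint attribute `μ₂`) is the mean of the second. -/
def attr (G : ProbabilityMeasure Obs) (k : Fin 2) : ℝ :=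
  ∫ x : Obs, x k ∂(G : Measure Obs)

/-- The two-dimensional Gaussian distributions with covariance matrix
`diag (1 / (2 a₁), 1 / (2 a₂))` and arbitrary mean. -/
def gaussianClass (a₁ a₂ : ℝ) : Set (ProbabilityMeasure Obs) :=
  {G | ∃ m : Obs, (G : Measure Obs) =
    multivariateGaussian m (Matrix.diagonal ![1 / (2 * a₁), 1 / (2 * a₂)])}

/-- Arm `i` is feasible: its constraint attribute is at most the threshold. -/
def FeasibleArm {K : ℕ} (τ : ℝ) (ν : Bandit K) (i : Fin K) : Prop :=
  attr (ν i) 1 ≤ τ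

/-- The instance is feasible: some arm is feasible. -/
def Feasible {K : ℕ} (τ : ℝ) (ν : Bandit K) : Prop :=
  ∃ i, FeasibleArm τ ν i

/-- Arm `i` is an optimal arm: in a feasible instance, it minimises the objective attribute among
the feasible arms; in an infeasible instance, it minimises the constraint attribute. -/
def OptimalArm {K : ℕ} (τ : ℝ) (ν : Bandit K) (i : Fin K) : Prop :=
  (Feasible τ ν ∧ FeasibleArm τ ν i ∧
      ∀ j, FeasibleArm τ ν j → attr (ν i) 0 ≤ attr (ν j) 0) ∨
    (¬ Feasible τ ν ∧ ∀ j, attr (ν i) 1 ≤ attr (ν j) 1)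

/-- Arm `i` is the unique optimal arm, `J = i`. -/
def IsTheOptimalArm {K : ℕ} (τ : ℝ) (ν : Bandit K) (i : Fin K) : Prop :=
  OptimalArm τ ν i ∧ ∀ j, OptimalArm τ ν j → j = i

/-- The record of the first `t` rounds: the arm pulled and the sample observed in each round. -/
abbrev History (K t : ℕ) : Type := Fin t → Fin K × Obs

/-- A (possibly randomised) fixed-budget algorithm. For every budget `T`, `pull T t` is the
conditional law of the arm pulled after `t` rounds given the history, and `output T` is the
conditional law of the output (recommended arm, feasibility flag) given the history of all `T`
rounds. Neither depends on the instance. -/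
structure Algorithm (K : ℕ) where
  pull : (T t : ℕ) → Kernel (History K t) (Fin K)
  pull_markov : ∀ T t, IsMarkovKernel (pull T t)
  output : (T : ℕ) → Kernel (History K T) (Fin K × Bool)
  output_markov : ∀ T, IsMarkovKernel (output T)

/-- The kernel that sends an arm to its distribution. -/
def armKernel {K : ℕ} (ν : Bandit K) : Kernel (Fin K) Obs :=
  Kernel.ofFunOfCountable fun i => (ν i : Measure Obs)

/-- One round: given the history, the arm is drawn from the algorithm's rule, and then the sample is
drawn from the distribution of that arm. -/
def roundKernel {K : ℕ} (alg : Algorithm K) (ν : Bandit K) (T t : ℕ) :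
    Kernel (History K t) (Fin K × Obs) :=
  alg.pull T t ⊗ₖ Kernel.prodMkLeft (History K t) (armKernel ν)

/-- The law of the first `t` rounds when the algorithm, run with budget `T`, plays against `ν`. -/
def historyLaw {K : ℕ} (alg : Algorithm K) (ν : Bandit K) (T : ℕ) :
    (t : ℕ) → Measure (History K t)
  | 0 => Measure.dirac Fin.elim0
  | t + 1 => (historyLaw alg ν T t ⊗ₘ roundKernel alg ν T t).map
      fun p => (Fin.snoc p.1 p.2 : History K (t + 1))

/-- The law of the output after `T` rounds. -/
def outputLaw {K : ℕ} (alg : Algorithm K) (ν : Bandit K) (T : ℕ) : Measure (Fin K × Bool) :=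
  (historyLaw alg ν T T).bind (alg.output T)

/-- The probability of error `e_T`: the probability that the recommended arm is not the optimal arm
or that the flag is not the correct one. -/
def errorProb {K : ℕ} (alg : Algorithm K) (τ : ℝ) (ν : Bandit K) (T : ℕ) : ℝ≥0∞ :=
  outputLaw alg ν T
    {p | ¬ IsTheOptimalArm τ ν p.1 ∨ ¬ (p.2 = true ↔ Feasible τ ν)}

/-- The algorithm is consistent over `(C, τ)`: its probability of error tends to `0` on every
instance (with a unique optimal arm) whose arm distributions belong to `C`. -/
def Consistent {K : ℕ} (alg : Algorithm K) (C : Set (ProbabilityMeasure Obs)) (τ : ℝ) : Prop :=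
  ∀ ν : Bandit K, (∀ i, ν i ∈ C) → (∃ i, IsTheOptimalArm τ ν i) →
    Tendsto (fun T => errorProb alg τ ν T) atTop (𝓝 0)

open Classical in
/-- The gap `δ(i, j)`, for an optimal arm `i` with attribute vector `m` and another arm `j` with
attribute vector `m'`. The cases are: `i`, `j` feasible; `i` feasible and `j` a deceiver;
`i` feasible and `j` infeasible and suboptimal; `i`, `j` infeasible. -/
def gapδ (a₁ a₂ τ : ℝ) (m m' : Fin 2 → ℝ) : ℝ :=
  if m 1 ≤ τ then
    if m' 1 ≤ τ then √a₁ * (m' 0 - m 0)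
    else if m' 0 ≤ m 0 then √a₂ * (m' 1 - τ)
    else max (√a₂ * (m' 1 - τ)) (√a₁ * (m' 0 - m 0))
  else √a₂ * (m' 1 - m 1)

/-- The constrained suboptimality gap `Δ(i, j)`. -/
def gapΔ (a₁ a₂ τ : ℝ) (m m' : Fin 2 → ℝ) : ℝ :=
  min (√a₂ * |τ - m 1|) (gapδ a₁ a₂ τ m m')

end

end ConstrainedBandit

open scoped NNReal

namespace ConstrainedBandit

/-! The argument is a change of measure. If `ν'` has a different correct answer, a consistent
algorithm answers correctly under `ν'` with probability near 1, and that same answer is an error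
under `ν`. So the error at `ν` cannot decay faster than the two output laws can separate.

The laws are compared by Hölder's inequality (`HolderBound`). The constants multiply along rounds,
even under adaptive sampling, so `1 - e_T(ν') ≤ M ^ T * e_T(ν) ^ (1 / p)`. For Gaussian arms one may
take `log M = (q - 1) * I`, where `I` bounds the Kullback-Leibler divergence of each arm. The error
exponent is then at most `p * (q - 1) * I = q * I`, and `q → 1` gives `I` (`limsup_errorProb_le`).

It remains to choose `ν'`: either the optimal arm crosses the threshold (`confusable_feasibility`),
or the other arm overtakes it (`confusable_gapδ`). A round samples only one arm, so moving both arms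
costs the maximum of the two divergences, not their sum. -/

/-- The measure `Q` is controlled by `P` through a Hölder inequality with exponent `p` and
constant `M`. -/
def HolderBound {Ω : Type*} [MeasurableSpace Ω] (P Q : Measure Ω) (p : ℝ) (M : ℝ≥0∞) : Prop :=
  ∀ f : Ω → ℝ≥0∞, Measurable f → ∫⁻ x, f x ∂Q ≤ M * (∫⁻ x, f x ^ p ∂P) ^ (1 / p)

/-! ### Calculus of Hölder bounds -/

section General

variable {Ω Ω' : Type*} [MeasurableSpace Ω] [MeasurableSpace Ω']

lemma HolderBound.mono {P Q : Measure Ω} {p : ℝ} {M N : ℝ≥0∞} (h : HolderBound P Q p M)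
    (hMN : M ≤ N) : HolderBound P Q p N :=
  fun f hf => (h f hf).trans (by gcongr)

lemma HolderBound.map {P Q : Measure Ω} {p : ℝ} {M : ℝ≥0∞} (h : HolderBound P Q p M)
    {g : Ω → Ω'} (hg : Measurable g) : HolderBound (P.map g) (Q.map g) p M := by
  intro f hf
  rw [lintegral_map hf hg, lintegral_map (hf.pow_const p) hg]
  exact h (fun x => f (g x)) (hf.comp hg)

/-- The algorithm's own randomness has the same kernels under both instances; this is why it
contributes only a factor 1. -/
lemma HolderBound.refl (P : Measure Ω) [IsProbabilityMeasure P] {p q : ℝ}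
    (hpq : p.HolderConjugate q) : HolderBound P P p 1 := by
  intro f hf
  have h := ENNReal.lintegral_mul_le_Lp_mul_Lq P hpq hf.aemeasurable
    (aemeasurable_const (b := (1 : ℝ≥0∞)))
  simpa using h

/-- Apply the bound on each fibre, then on the base to the fibrewise `L^p` norm, whose `p`-th power
undoes the root. Only a uniform fibre constant is needed, so adaptive sampling costs no more than
the worst arm. -/
lemma HolderBound.compProd {P Q : Measure Ω} [SFinite P] [SFinite Q] {p : ℝ} (hp : 0 < p)
    {M N : ℝ≥0∞} {κ η : Kernel Ω Ω'} [IsSFiniteKernel κ] [IsSFiniteKernel η]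
    (h : HolderBound P Q p M) (hκ : ∀ a, HolderBound (κ a) (η a) p N) :
    HolderBound (P ⊗ₘ κ) (Q ⊗ₘ η) p (M * N) := by
  intro f hf
  have hfp : Measurable fun x => f x ^ p := hf.pow_const p
  rw [Measure.lintegral_compProd hf, Measure.lintegral_compProd hfp]
  have hm : Measurable fun a => ∫⁻ b, f (a, b) ^ p ∂(κ a) := hfp.lintegral_kernel_prod_right'
  calc ∫⁻ a, ∫⁻ b, f (a, b) ∂(η a) ∂Q
      ≤ ∫⁻ a, N * (∫⁻ b, f (a, b) ^ p ∂(κ a)) ^ (1 / p) ∂Q :=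
        lintegral_mono fun a => hκ a _ (hf.comp measurable_prodMk_left)
    _ = N * ∫⁻ a, (∫⁻ b, f (a, b) ^ p ∂(κ a)) ^ (1 / p) ∂Q :=
        lintegral_const_mul _ (hm.pow_const _)
    _ ≤ N * (M * (∫⁻ a, ((∫⁻ b, f (a, b) ^ p ∂(κ a)) ^ (1 / p)) ^ p ∂P) ^ (1 / p)) := by
        gcongr
        exact h _ (hm.pow_const _)
    _ = M * N * (∫⁻ a, ∫⁻ b, f (a, b) ^ p ∂(κ a) ∂P) ^ (1 / p) := by
        simp_rw [← ENNReal.rpow_mul, one_div_mul_cancel hp.ne', ENNReal.rpow_one]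
        ring

lemma HolderBound.prod {P Q : Measure Ω} {P' Q' : Measure Ω'} [SFinite P] [SFinite Q]
    [SFinite P'] [SFinite Q'] {p : ℝ} (hp : 0 < p) {M N : ℝ≥0∞} (h : HolderBound P Q p M)
    (h' : HolderBound P' Q' p N) : HolderBound (P.prod P') (Q.prod Q') p (M * N) := by
  rw [← Measure.compProd_const, ← Measure.compProd_const]
  exact h.compProd hp fun _ => by simpa using h'

lemma HolderBound.measure_le {P Q : Measure Ω} {p : ℝ} (hp : 0 < p) {M : ℝ≥0∞}
    (h : HolderBound P Q p M) {s : Set Ω} (hs : MeasurableSet s) :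
    Q s ≤ M * P s ^ (1 / p) := by
  have := h (s.indicator 1) (measurable_one.indicator hs)
  rw [lintegral_indicator_one hs] at this
  have e : (fun x => s.indicator (1 : Ω → ℝ≥0∞) x ^ p) = s.indicator 1 := by
    ext x
    by_cases hx : x ∈ s <;> simp [hx, hp]
  rwa [e, lintegral_indicator_one hs] at this

end General

/-! ### Gaussian likelihood ratios -/

/-- Complete the square: the exponential on the left is the `s`-th power of the likelihood ratio for
a shift of the mean by `d`. Taking `s = 1` changes the measure; `s = q` gives the `q`-th moment of
the ratio. -/
lemma gaussianPDF_tilt (m d : ℝ) {v : ℝ≥0} (hv : v ≠ 0) (s x : ℝ) :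
    ENNReal.ofReal (Real.exp (s * (d * (x - m) / v - d ^ 2 / (2 * v)))) * gaussianPDF m v x =
      ENNReal.ofReal (Real.exp ((s ^ 2 - s) * (d ^ 2 / (2 * v)))) *
        gaussianPDF (m + s * d) v x := by
  have hv' : (v : ℝ) ≠ 0 := by exact_mod_cast hv
  simp only [gaussianPDF, gaussianPDFReal]
  rw [← ENNReal.ofReal_mul (Real.exp_nonneg _), ← ENNReal.ofReal_mul (Real.exp_nonneg _)]
  congr 1
  rw [mul_left_comm, mul_left_comm (Real.exp _), ← Real.exp_add, ← Real.exp_add]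
  congr 2
  field_simp
  ring

/-- The constant is the `L^q` norm of the likelihood ratio: its `q`-th moment has exponent `(q ^ 2 -
q) * (d ^ 2 / (2 * v))`, and the `q`-th root leaves the factor `q - 1`. -/
lemma holderBound_gaussianReal (m m' : ℝ) {v : ℝ≥0} (hv : v ≠ 0) {p q : ℝ}
    (hpq : p.HolderConjugate q) :
    HolderBound (gaussianReal m v) (gaussianReal m' v) p
      (ENNReal.ofReal (Real.exp ((q - 1) * ((m' - m) ^ 2 / (2 * v))))) := by
  intro f hf
  set d := m' - m with hd
  set r : ℝ → ℝ≥0∞ := fun x =>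
    ENNReal.ofReal (Real.exp (d * (x - m) / v - d ^ 2 / (2 * v))) with hr
  have hrm : Measurable r := by fun_prop
  have hq : q ≠ 0 := hpq.symm.ne_zero
  have key : ∫⁻ x, f x ∂(gaussianReal m' v) = ∫⁻ x, (f * r) x ∂(gaussianReal m v) := by
    rw [gaussianReal_of_var_ne_zero _ hv, gaussianReal_of_var_ne_zero _ hv,
      lintegral_withDensity_eq_lintegral_mul _ (measurable_gaussianPDF _ _) hf,
      lintegral_withDensity_eq_lintegral_mul _ (measurable_gaussianPDF _ _) (hf.mul hrm)]
    refine lintegral_congr fun x => ?_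
    have := gaussianPDF_tilt m d hv 1 x
    simp only [one_mul, one_pow, sub_self, zero_mul, Real.exp_zero, ENNReal.ofReal_one] at this
    rw [show m + d = m' by rw [hd]; ring] at this
    simp only [Pi.mul_apply, ← this, hr]
    ring
  have hrq : ∫⁻ x, r x ^ q ∂(gaussianReal m v) =
      ENNReal.ofReal (Real.exp ((q ^ 2 - q) * (d ^ 2 / (2 * v)))) := by
    rw [gaussianReal_of_var_ne_zero _ hv,
      lintegral_withDensity_eq_lintegral_mul _ (measurable_gaussianPDF _ _) (hrm.pow_const q)]
    calc _ = ∫⁻ x, ENNReal.ofReal (Real.exp ((q ^ 2 - q) * (d ^ 2 / (2 * v)))) *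
          gaussianPDF (m + q * d) v x := by
          refine lintegral_congr fun x => ?_
          rw [← gaussianPDF_tilt m d hv q x, Pi.mul_apply, mul_comm, hr,
            ENNReal.ofReal_rpow_of_pos (Real.exp_pos _), ← Real.exp_mul, mul_comm q]
      _ = _ := by
          rw [lintegral_const_mul _ (measurable_gaussianPDF _ _), lintegral_gaussianPDF_eq_one _ hv,
            mul_one]
  rw [key]
  refine (ENNReal.lintegral_mul_le_Lp_mul_Lq _ hpq hf.aemeasurable hrm.aemeasurable).trans ?_
  rw [hrq, ENNReal.ofReal_rpow_of_pos (Real.exp_pos _), ← Real.exp_mul, mul_comm]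
  apply le_of_eq
  congr 3
  field_simp

/-- A Gaussian vector with diagonal covariance matrix has independent coordinates. -/
lemma multivariateGaussian_diagonal {ι : Type*} [Fintype ι] [DecidableEq ι]
    (m : EuclideanSpace ℝ ι) (v : ι → ℝ≥0) :
    multivariateGaussian m (Matrix.diagonal fun k => (v k : ℝ)) =
      (Measure.pi fun k => gaussianReal (m k) (v k)).map (WithLp.toLp 2) := by
  have hS : (Matrix.diagonal fun k => (v k : ℝ)).PosSemidef :=
    Matrix.PosSemidef.diagonal fun k => (v k).2
  have : IsProbabilityMeasure
      ((Measure.pi fun k => gaussianReal (m k) (v k)).map (WithLp.toLp 2)) :=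
    Measure.isProbabilityMeasure_map (by fun_prop)
  apply Measure.ext_of_charFun (E := EuclideanSpace ℝ ι)
  ext t
  rw [charFun_multivariateGaussian hS, charFun_pi]
  simp_rw [charFun_gaussianReal, ← Complex.exp_sum]
  congr 1
  simp only [Matrix.mulVec_diagonal, dotProduct, PiLp.inner_apply, Finset.sum_sub_distrib]
  push_cast
  rw [Finset.sum_mul, Finset.sum_div]
  congr 1
  · refine Finset.sum_congr rfl fun k _ => ?_
    simp
    ring
  · refine Finset.sum_congr rfl fun k _ => ?_
    ring

lemma holderBound_multivariateGaussian {a₁ a₂ : ℝ} (ha₁ : 0 < a₁) (ha₂ : 0 < a₂)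
    (m m' : EuclideanSpace ℝ (Fin 2)) {p q : ℝ} (hpq : p.HolderConjugate q) :
    HolderBound (multivariateGaussian m (Matrix.diagonal ![1 / (2 * a₁), 1 / (2 * a₂)]))
      (multivariateGaussian m' (Matrix.diagonal ![1 / (2 * a₁), 1 / (2 * a₂)])) p
      (ENNReal.ofReal (Real.exp
        ((q - 1) * (a₁ * (m' 0 - m 0) ^ 2 + a₂ * (m' 1 - m 1) ^ 2)))) := by
  set v : Fin 2 → ℝ≥0 := ![(1 / (2 * a₁)).toNNReal, (1 / (2 * a₂)).toNNReal] with hv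
  have e0 : (v 0 : ℝ) = 1 / (2 * a₁) := Real.coe_toNNReal _ (by positivity)
  have e1 : (v 1 : ℝ) = 1 / (2 * a₂) := Real.coe_toNNReal _ (by positivity)
  have h0 : v 0 ≠ 0 := by
    intro h; rw [h] at e0
    simp at e0
    exact ha₁.ne' e0
  have h1 : v 1 ≠ 0 := by
    intro h; rw [h] at e1
    simp at e1
    exact ha₂.ne' e1
  have hvv : ![1 / (2 * a₁), 1 / (2 * a₂)] = fun k => (v k : ℝ) := by
    ext k; fin_cases k
    · exact e0.symm
    · exact e1.symm
  have hpi : ∀ n : EuclideanSpace ℝ (Fin 2), Measure.pi (fun k => gaussianReal (n k) (v k)) =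
      ((gaussianReal (n 0) (v 0)).prod (gaussianReal (n 1) (v 1))).map
        (MeasurableEquiv.piFinTwo fun _ => ℝ).symm := fun n =>
    ((measurePreserving_piFinTwo fun k => gaussianReal (n k) (v k)).symm).map_eq.symm
  rw [hvv, multivariateGaussian_diagonal, multivariateGaussian_diagonal, hpi, hpi]
  have h := (holderBound_gaussianReal (m 0) (m' 0) h0 hpq).prod hpq.pos
    (holderBound_gaussianReal (m 1) (m' 1) h1 hpq)
  refine ((h.map (MeasurableEquiv.measurable _)).map (by fun_prop)).mono (le_of_eq ?_)
  rw [← ENNReal.ofReal_mul (Real.exp_nonneg _), ← Real.exp_add, e0, e1]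
  congr 2
  field_simp

/-! ### Change of measure for the bandit game -/

section ChangeOfMeasure

variable {K : ℕ}

instance (alg : Algorithm K) (T t : ℕ) : IsMarkovKernel (alg.pull T t) := alg.pull_markov T t

instance (alg : Algorithm K) (T : ℕ) : IsMarkovKernel (alg.output T) := alg.output_markov T

instance (ν : Bandit K) : IsMarkovKernel (armKernel ν) :=
  ⟨fun i => inferInstanceAs (IsProbabilityMeasure (ν i : Measure Obs))⟩

instance (alg : Algorithm K) (ν : Bandit K) (T t : ℕ) : IsMarkovKernel (roundKernel alg ν T t) :=
  inferInstanceAs (IsMarkovKernel (_ ⊗ₖ _))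

lemma measurable_snoc_history (t : ℕ) :
    Measurable fun p : History K t × (Fin K × Obs) => (Fin.snoc p.1 p.2 : History K (t + 1)) := by
  refine measurable_pi_lambda _ fun k => ?_
  refine Fin.lastCases ?_ (fun k => ?_) k
  · simpa using measurable_snd
  · simp only [Fin.snoc_castSucc]
    exact (measurable_pi_apply k).comp measurable_fst

instance (alg : Algorithm K) (ν : Bandit K) (T t : ℕ) :
    IsProbabilityMeasure (historyLaw alg ν T t) := by
  induction t with
  | zero => exact inferInstanceAs (IsProbabilityMeasure (Measure.dirac _))
  | succ t ih =>
    exact Measure.isProbabilityMeasure_map (measurable_snoc_history t).aemeasurable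

instance (alg : Algorithm K) (ν : Bandit K) (T : ℕ) : IsProbabilityMeasure (outputLaw alg ν T) :=
  inferInstanceAs (IsProbabilityMeasure (Measure.bind _ _))

variable {ν ν' : Bandit K} {p q : ℝ} {M : ℝ≥0∞}

lemma holderBound_roundKernel (alg : Algorithm K) (hpq : p.HolderConjugate q)
    (h : ∀ k, HolderBound (ν k : Measure Obs) (ν' k) p M) (T t : ℕ) (x : History K t) :
    HolderBound (roundKernel alg ν T t x) (roundKernel alg ν' T t x) p M := by
  have e : ∀ ν : Bandit K, roundKernel alg ν T t x = alg.pull T t x ⊗ₘ armKernel ν := by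
    intro ν
    rw [roundKernel, Kernel.compProd_apply_eq_compProd_sectR]
    rfl
  rw [e, e]
  exact ((HolderBound.refl _ hpq).compProd hpq.pos (κ := armKernel ν) (η := armKernel ν')
    fun k => h k).mono (by rw [one_mul])

lemma holderBound_historyLaw (alg : Algorithm K) (hpq : p.HolderConjugate q)
    (h : ∀ k, HolderBound (ν k : Measure Obs) (ν' k) p M) (T t : ℕ) :
    HolderBound (historyLaw alg ν T t) (historyLaw alg ν' T t) p (M ^ t) := by
  induction t with
  | zero => exact (HolderBound.refl _ hpq).mono (by simp)
  | succ t ih =>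
    exact ((ih.compProd hpq.pos (holderBound_roundKernel alg hpq h T t)).map
      (measurable_snoc_history t)).mono (by rw [pow_succ])

lemma holderBound_outputLaw (alg : Algorithm K) (hpq : p.HolderConjugate q)
    (h : ∀ k, HolderBound (ν k : Measure Obs) (ν' k) p M) (T : ℕ) :
    HolderBound (outputLaw alg ν T) (outputLaw alg ν' T) p (M ^ T) := by
  have e : ∀ ν : Bandit K, outputLaw alg ν T =
      (historyLaw alg ν T T ⊗ₘ alg.output T).map Prod.snd := fun ν =>
    (Measure.snd_compProd _ _).symm
  rw [e, e]
  exact (((holderBound_historyLaw alg hpq h T T).compProd hpq.pos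
    (κ := alg.output T) (η := alg.output T) fun x => HolderBound.refl _ hpq).map
      measurable_snd).mono (by rw [mul_one])

/-- No arm and flag are the correct answer for both instances. -/
def Disagree (τ : ℝ) (ν ν' : Bandit K) : Prop :=
  ∀ i, ¬ (IsTheOptimalArm τ ν i ∧ IsTheOptimalArm τ ν' i ∧ (Feasible τ ν ↔ Feasible τ ν'))

/-- The complement of the error event of `ν'` lies inside the error event of `ν`, to which the
Hölder bound is applied. -/
lemma one_sub_errorProb_le (alg : Algorithm K) {τ : ℝ} (hd : Disagree τ ν ν')
    (hpq : p.HolderConjugate q) (h : ∀ k, HolderBound (ν k : Measure Obs) (ν' k) p M) (T : ℕ) :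
    1 - errorProb alg τ ν' T ≤ M ^ T * errorProb alg τ ν T ^ (1 / p) := by
  refine le_trans ?_ ((holderBound_outputLaw alg hpq h T).measure_le hpq.pos
    (Set.toFinite _).measurableSet)
  rw [errorProb, ← prob_compl_eq_one_sub (Set.toFinite _).measurableSet]
  refine measure_mono fun x hx => ?_
  simp only [Set.mem_compl_iff, Set.mem_ofPred_eq, not_or, not_not] at hx
  by_contra hc
  simp only [Set.mem_ofPred_eq, not_or, not_not] at hc
  exact hd x.1 ⟨hc.1, hx.1, hc.2.symm.trans hx.2⟩

/-- The change-of-measure bound: the error exponent at `ν` is at most any bound on the information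
per round that separates `ν` from an instance with another answer. -/
lemma limsup_errorProb_le (alg : Algorithm K) {τ : ℝ} (hd : Disagree τ ν ν')
    (hν' : Tendsto (fun T => errorProb alg τ ν' T) atTop (𝓝 0)) {I : ℝ}
    (h : ∀ p q : ℝ, p.HolderConjugate q → ∀ k, HolderBound (ν k : Measure Obs) (ν' k) p
      (ENNReal.ofReal (Real.exp ((q - 1) * I)))) :
    limsup (fun T : ℕ => ((-(1 / (T : ℝ)) : ℝ) : EReal) *
        ENNReal.log (errorProb alg τ ν T)) atTop ≤ (I : EReal) := by
  refine EReal.le_of_forall_lt_iff_le.1 fun L hL => ?_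
  have hL : I < L := by exact_mod_cast hL
  obtain ⟨q, hq1, hqL⟩ : ∃ q : ℝ, 1 < q ∧ q * I < L := by
    have : Tendsto (fun q : ℝ => q * I) (𝓝[>] 1) (𝓝 (1 * I)) :=
      ((continuous_id.mul continuous_const).tendsto 1).mono_left nhdsWithin_le_nhds
    rw [one_mul] at this
    obtain ⟨q, h1, h2⟩ := ((this.eventually_lt_const hL).and self_mem_nhdsWithin).exists
    exact ⟨q, h2, h1⟩
  set p := Real.conjExponent q with hp
  have hpq : p.HolderConjugate q := (Real.HolderConjugate.conjExponent hq1).symm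
  have hp0 : 0 < p := hpq.pos
  -- Undoing the root `1 / p` turns the rate `q - 1` into `q`, which stays bounded as `q → 1`
  -- although `p → ∞`.
  have hpq1 : p * (q - 1) = q := by
    have : q - 1 ≠ 0 := by linarith
    rw [hp, Real.conjExponent]; field_simp
  have hsmall : ∀ᶠ T : ℕ in atTop, p * Real.log 2 / T + q * I < L := by
    have : Tendsto (fun T : ℕ => p * Real.log 2 / T + q * I) atTop (𝓝 (0 + q * I)) :=
      (tendsto_const_div_atTop_nhds_zero_nat _).add_const _
    exact this.eventually_lt_const (by simpa using hqL)
  have hhalf : ∀ᶠ T : ℕ in atTop, errorProb alg τ ν' T < 2⁻¹ :=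
    hν'.eventually_lt_const (by simp)
  refine limsup_le_of_le (by isBoundedDefault) ?_
  filter_upwards [hsmall, hhalf, eventually_gt_atTop 0] with T hT1 hT2 hT0
  have hT : (0 : ℝ) < T := by exact_mod_cast hT0
  have hbound : (2⁻¹ : ℝ≥0∞) ≤ ENNReal.ofReal (Real.exp ((q - 1) * I)) ^ T *
      errorProb alg τ ν T ^ (1 / p) := by
    refine le_trans ?_ (one_sub_errorProb_le alg hd hpq (h p q hpq) T)
    rw [← ENNReal.one_sub_inv_two]
    gcongr
  have hfin : errorProb alg τ ν T ≠ ∞ := measure_ne_top _ _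
  -- A zero error would contradict `hbound`, so the value of `log 0` plays no role for these `T`.
  have hpos : errorProb alg τ ν T ≠ 0 := by
    intro h0
    rw [h0, ENNReal.zero_rpow_of_pos (by positivity), mul_zero] at hbound
    simp at hbound
  obtain ⟨e, he, hee⟩ : ∃ e : ℝ, 0 < e ∧ errorProb alg τ ν T = ENNReal.ofReal e :=
    ⟨_, ENNReal.toReal_pos hpos hfin, (ENNReal.ofReal_toReal hfin).symm⟩
  rw [hee] at hbound ⊢
  rw [ENNReal.log_ofReal_of_pos he, ← EReal.coe_mul, EReal.coe_le_coe_iff]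
  rw [ENNReal.ofReal_rpow_of_pos he, ← ENNReal.ofReal_pow (Real.exp_nonneg _),
    ← ENNReal.ofReal_mul (by positivity), ← Real.exp_nat_mul,
    show (2⁻¹ : ℝ≥0∞) = ENNReal.ofReal 2⁻¹ by
      rw [ENNReal.ofReal_inv_of_pos two_pos]; simp,
    ENNReal.ofReal_le_ofReal_iff (by positivity)] at hbound
  have hlog := Real.log_le_log (by positivity) hbound
  rw [Real.log_mul (by positivity) (by positivity), Real.log_exp, Real.log_rpow he,
    Real.log_inv] at hlog
  have h2 : -Real.log e ≤ p * Real.log 2 + T * (q * I) := by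
    have := mul_le_mul_of_nonneg_left hlog hp0.le
    have e1 : p * (T * ((q - 1) * I) + 1 / p * Real.log e) =
        T * ((p * (q - 1)) * I) + Real.log e := by
      field_simp
    rw [e1, hpq1] at this
    linarith
  calc -(1 / (T : ℝ)) * Real.log e = -Real.log e / T := by ring
    _ ≤ (p * Real.log 2 + T * (q * I)) / T := by gcongr
    _ = p * Real.log 2 / T + q * I := by field_simp
    _ ≤ L := hT1.le

end ChangeOfMeasure

/-! ### Optimality for two arms in terms of attributes -/

section TwoArms

lemma forall_fin_two {i j : Fin 2} (hij : i ≠ j) {P : Fin 2 → Prop} :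
    (∀ k, P k) ↔ P i ∧ P j := by
  fin_cases i <;> fin_cases j <;> simp_all [Fin.forall_fin_two, and_comm]

lemma feasible_iff {τ : ℝ} {ν : Bandit 2} {i j : Fin 2} (hij : i ≠ j) :
    Feasible τ ν ↔ attr (ν i) 1 ≤ τ ∨ attr (ν j) 1 ≤ τ := by
  have := forall_fin_two hij (P := fun k => ¬ attr (ν k) 1 ≤ τ)
  rw [← not_iff_not, Feasible, not_exists, not_or]
  exact this

/-- An arm with attribute vector `x` is the unique optimal one against an arm with attribute
vector `y`. -/
def Beats (τ : ℝ) (x y : Fin 2 → ℝ) : Prop :=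
  (x 1 ≤ τ ∧ τ < y 1) ∨ (x 1 ≤ τ ∧ y 1 ≤ τ ∧ x 0 < y 0) ∨ (τ < x 1 ∧ τ < y 1 ∧ x 1 < y 1)

lemma isTheOptimalArm_iff {τ : ℝ} {ν : Bandit 2} {i j : Fin 2} (hij : i ≠ j) :
    IsTheOptimalArm τ ν i ↔ Beats τ (attr (ν i)) (attr (ν j)) := by
  simp only [IsTheOptimalArm, OptimalArm, FeasibleArm, feasible_iff hij, forall_fin_two hij, Beats,
    hij.symm, not_or, not_le]
  rcases le_or_gt (attr (ν i) 1) τ with h1 | h1 <;> rcases le_or_gt (attr (ν j) 1) τ with h2 | h2 <;>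
    simp only [h1, h2, true_and, not_le_of_gt, not_lt_of_ge, and_true, or_false, false_or, false_and,
      and_false, or_true, not_false_eq_true, true_imp_iff, false_imp_iff, imp_false] <;>
    grind

end TwoArms

variable {a₁ a₂ τ : ℝ}

lemma attr_of_eq_multivariateGaussian {G : ProbabilityMeasure Obs} {m : Obs}
    {S : Matrix (Fin 2) (Fin 2) ℝ} (h : (G : Measure Obs) = multivariateGaussian m S) (k : Fin 2) :
    attr G k = m k := by
  have := (EuclideanSpace.proj k : Obs →L[ℝ] ℝ).integral_comp_id_comm
    (μ := multivariateGaussian m S) IsGaussian.integrable_id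
  rw [integral_id_multivariateGaussian] at this
  rw [attr, h]
  exact this

lemma exists_mem_gaussianClass (a₁ a₂ : ℝ) (x : Fin 2 → ℝ) :
    ∃ G ∈ gaussianClass a₁ a₂, attr G = x := by
  let G : ProbabilityMeasure Obs := ⟨multivariateGaussian (WithLp.toLp 2 x)
    (Matrix.diagonal ![1 / (2 * a₁), 1 / (2 * a₂)]), inferInstance⟩
  have hG : (G : Measure Obs) = multivariateGaussian (WithLp.toLp 2 x) _ := rfl
  exact ⟨G, ⟨_, hG⟩, funext fun k => attr_of_eq_multivariateGaussian hG k⟩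

lemma holderBound_gaussianClass (ha₁ : 0 < a₁) (ha₂ : 0 < a₂) {G G' : ProbabilityMeasure Obs}
    (hG : G ∈ gaussianClass a₁ a₂) (hG' : G' ∈ gaussianClass a₁ a₂) {p q : ℝ}
    (hpq : p.HolderConjugate q) {I : ℝ}
    (hI : a₁ * (attr G' 0 - attr G 0) ^ 2 + a₂ * (attr G' 1 - attr G 1) ^ 2 ≤ I) :
    HolderBound (G : Measure Obs) G' p (ENNReal.ofReal (Real.exp ((q - 1) * I))) := by
  obtain ⟨m, hm⟩ := hG
  obtain ⟨m', hm'⟩ := hG'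
  simp only [attr_of_eq_multivariateGaussian hm, attr_of_eq_multivariateGaussian hm'] at hI
  rw [hm, hm']
  have : 0 ≤ q - 1 := sub_nonneg.2 hpq.symm.lt.le
  exact (holderBound_multivariateGaussian ha₁ ha₂ m m' hpq).mono (by gcongr)

/-- The information per round needed to tell an arm with attributes `x` from one with attributes
`x'`. -/
noncomputable def info (a₁ a₂ : ℝ) (x x' : Fin 2 → ℝ) : ℝ :=
  a₁ * (x' 0 - x 0) ^ 2 + a₂ * (x' 1 - x 1) ^ 2

lemma limsup_errorProb_le_of_attr (ha₁ : 0 < a₁) (ha₂ : 0 < a₂) (alg : Algorithm 2)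
    (hcons : Consistent alg (gaussianClass a₁ a₂) τ) (ν : Bandit 2)
    (hν : ∀ k, ν k ∈ gaussianClass a₁ a₂) {i j : Fin 2} (hij : i ≠ j)
    (x y : Fin 2 → ℝ) {I : ℝ} (hx : info a₁ a₂ (attr (ν i)) x ≤ I)
    (hy : info a₁ a₂ (attr (ν j)) y ≤ I)
    (hi : Beats τ (attr (ν i)) (attr (ν j)))
    (hxy : Beats τ y x ∨ Beats τ x y ∧
      ¬ (attr (ν i) 1 ≤ τ ∨ attr (ν j) 1 ≤ τ ↔ x 1 ≤ τ ∨ y 1 ≤ τ)) :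
    limsup (fun T : ℕ => ((-(1 / (T : ℝ)) : ℝ) : EReal) *
        ENNReal.log (errorProb alg τ ν T)) atTop ≤ (I : EReal) := by
  obtain ⟨G, hG, rfl⟩ := exists_mem_gaussianClass a₁ a₂ x
  obtain ⟨H, hH, rfl⟩ := exists_mem_gaussianClass a₁ a₂ y
  let ν' : Bandit 2 := fun k => if k = i then G else H
  have ei : ν' i = G := by simp [ν']
  have ej : ν' j = H := by simp [ν', hij.symm]
  have hi' := (isTheOptimalArm_iff hij).2 hi
  have hν' : ∀ k, ν' k ∈ gaussianClass a₁ a₂ := by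
    rw [forall_fin_two hij, ei, ej]
    exact ⟨hG, hH⟩
  rw [← ei, ← ej, ← isTheOptimalArm_iff hij, ← isTheOptimalArm_iff hij.symm, ← feasible_iff hij,
    ← feasible_iff hij] at hxy
  refine limsup_errorProb_le alg (ν' := ν') ?_ (hcons ν' hν' ?_) ?_
  · rintro k ⟨hk, hk', hF⟩
    obtain rfl := hi'.2 k hk.1
    rcases hxy with h | h
    · exact hij (h.2 _ hk'.1)
    · exact h.2 hF
  · rcases hxy with h | h
    exacts [⟨j, h⟩, ⟨i, h.1⟩]
  · intro p q hpq
    rw [forall_fin_two hij]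
    refine ⟨holderBound_gaussianClass ha₁ ha₂ (hν i) (hν' i) hpq ?_,
      holderBound_gaussianClass ha₁ ha₂ (hν j) (hν' j) hpq ?_⟩
    · rwa [ei]
    · rwa [ej]

/-- Overtaking must be strict, so in general the optimal cost is only approached by perturbations
with `ε > 0`; continuity recovers it. -/
lemma ereal_le_of_eventually {X : EReal} {g : ℝ → ℝ} (hg : Continuous g)
    (h : ∀ᶠ ε in 𝓝[>] 0, X ≤ (g ε : EReal)) : X ≤ (g 0 : EReal) :=
  ge_of_tendsto (((continuous_coe_real_ereal.comp hg).tendsto 0).mono_left nhdsWithin_le_nhds) h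

/-! ### Choice of the confusing instances -/

/-- The instance with attributes `x`, `y` and with first arm optimal can be confused, up to an
arbitrarily small perturbation, at a cost of `I` per round. -/
def Confusable (a₁ a₂ τ : ℝ) (x y : Fin 2 → ℝ) (I : ℝ) : Prop :=
  ∃ g : ℝ → ℝ, Continuous g ∧ g 0 = I ∧ ∀ᶠ ε in 𝓝[>] (0 : ℝ), ∃ x' y' : Fin 2 → ℝ,
    info a₁ a₂ x x' ≤ g ε ∧ info a₁ a₂ y y' ≤ g ε ∧
      (Beats τ y' x' ∨ Beats τ x' y' ∧ ¬ (x 1 ≤ τ ∨ y 1 ≤ τ ↔ x' 1 ≤ τ ∨ y' 1 ≤ τ))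

lemma info_self (x : Fin 2 → ℝ) : info a₁ a₂ x x = 0 := by simp [info]

lemma eventually_lt_nhdsGT_zero {c : ℝ} (hc : 0 < c) : ∀ᶠ ε in 𝓝[>] (0 : ℝ), 0 < ε ∧ ε < c :=
  Ioo_mem_nhdsGT hc

lemma confusable_feasibility (ha₂ : 0 < a₂) {x y : Fin 2 → ℝ}
    (hxy : Beats τ x y) : Confusable a₁ a₂ τ x y (a₂ * (τ - x 1) ^ 2) := by
  rcases le_or_gt (x 1) τ with hx | hx
  · refine ⟨fun ε => a₂ * (τ + ε - x 1) ^ 2, by fun_prop, by simp, ?_⟩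
    rcases le_or_gt (y 1) τ with hy | hy
    -- Arm `y` becomes the only feasible one.
    · filter_upwards [self_mem_nhdsWithin] with ε (hε : 0 < ε)
      refine ⟨![x 0, τ + ε], y, by simp [info], by rw [info_self]; positivity, Or.inl (Or.inl ?_)⟩
      simpa using ⟨hy, hε⟩
    -- With `ε < y 1 - τ` the raised arm is still optimal, now in an infeasible instance: only the
    -- flag changes.
    · filter_upwards [eventually_lt_nhdsGT_zero (sub_pos.2 hy)] with ε hε
      refine ⟨![x 0, τ + ε], y, by simp [info], by rw [info_self]; positivity,
        Or.inr ⟨Or.inr (Or.inr ?_), ?_⟩⟩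
      · simpa using ⟨hε.1, hy, by linarith⟩
      · simp [hx, hy, hε.1]
  · have hy : τ < y 1 := by
      rcases hxy with h | h | h
      exacts [h.2, absurd h.1 hx.not_ge, h.2.1]
    -- The threshold itself is feasible, so no `ε` is needed here.
    refine ⟨fun ε => a₂ * (τ - x 1) ^ 2, by fun_prop, by simp, .of_forall fun ε => ?_⟩
    refine ⟨![x 0, τ], y, by simp [info], by rw [info_self]; positivity, Or.inr ⟨Or.inl ?_, ?_⟩⟩
    · simpa using hy
    · simp [hx, hy]

lemma confusable_gapδ (ha₁ : 0 < a₁) (ha₂ : 0 < a₂) {x y : Fin 2 → ℝ}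
    (hxy : Beats τ x y) : Confusable a₁ a₂ τ x y (gapδ a₁ a₂ τ x y ^ 2) := by
  unfold gapδ
  split_ifs with hx hy h0
  · refine ⟨fun ε => a₁ * (x 0 - ε - y 0) ^ 2, by fun_prop, ?_, ?_⟩
    · rw [mul_pow, Real.sq_sqrt ha₁.le]; ring
    · filter_upwards [self_mem_nhdsWithin] with ε (hε : 0 < ε)
      refine ⟨x, ![x 0 - ε, y 1], by rw [info_self]; positivity, by simp [info],
        Or.inl (Or.inr (Or.inl ?_))⟩
      simpa using ⟨hy, hx, hε⟩
  · refine ⟨fun ε => a₁ * ε ^ 2 + a₂ * (y 1 - τ) ^ 2, by fun_prop, ?_, ?_⟩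
    · rw [mul_pow, Real.sq_sqrt ha₂.le]; ring
    · filter_upwards [self_mem_nhdsWithin] with ε (hε : 0 < ε)
      -- Moving the constraint to `τ` makes the deceiver feasible; `ε` breaks a possible tie `y 0 =
      -- x 0`.
      refine ⟨x, ![y 0 - ε, τ], by rw [info_self]; positivity, le_of_eq ?_,
        Or.inl (Or.inr (Or.inl ?_))⟩
      · simp [info, sub_sq_comm]
      · simpa using ⟨hx, by linarith⟩
  · rw [not_le] at hy h0
    refine ⟨fun ε => max (a₂ * (y 1 - τ) ^ 2) (a₁ * (y 0 + ε - x 0) ^ 2), by fun_prop, ?_, ?_⟩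
    · have h1 : 0 ≤ √a₂ * (y 1 - τ) := mul_nonneg (Real.sqrt_nonneg _) (by linarith)
      have h2 : 0 ≤ √a₁ * (y 0 - x 0) := mul_nonneg (Real.sqrt_nonneg _) (by linarith)
      have e1 : a₂ * (y 1 - τ) ^ 2 = (√a₂ * (y 1 - τ)) ^ 2 := by
        rw [mul_pow, Real.sq_sqrt ha₂.le]
      have e2 : a₁ * (y 0 + 0 - x 0) ^ 2 = (√a₁ * (y 0 - x 0)) ^ 2 := by
        rw [mul_pow, Real.sq_sqrt ha₁.le, add_zero]
      simp only [e1, e2]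
      rcases le_total (√a₂ * (y 1 - τ)) (√a₁ * (y 0 - x 0)) with h | h
      · rw [max_eq_right h, max_eq_right (pow_le_pow_left₀ h1 h 2)]
      · rw [max_eq_left h, max_eq_left (pow_le_pow_left₀ h2 h 2)]
    · filter_upwards [self_mem_nhdsWithin] with ε (hε : 0 < ε)
      -- Both arms move, each in one coordinate: `y` becomes feasible and `x` gets the worse
      -- objective.
      refine ⟨![y 0 + ε, x 1], ![y 0, τ], le_max_of_le_right (by simp [info]),
        le_max_of_le_left (le_of_eq ?_), Or.inl (Or.inr (Or.inl ?_))⟩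
      · simp [info, sub_sq_comm]
      · simpa using ⟨hx, hε⟩
  · rw [not_le] at hx
    have hy : τ < y 1 := by
      rcases hxy with h | h | h
      exacts [h.2, absurd h.1 hx.not_ge, h.2.1]
    refine ⟨fun ε => a₂ * (x 1 - ε - y 1) ^ 2, by fun_prop, ?_, ?_⟩
    · rw [mul_pow, Real.sq_sqrt ha₂.le]; ring
    -- The bound `ε < x 1 - τ` keeps the lowered arm infeasible, so the constraint attribute still
    -- decides.
    · filter_upwards [eventually_lt_nhdsGT_zero (sub_pos.2 hx)] with ε hε
      refine ⟨x, ![y 0, x 1 - ε], by rw [info_self]; positivity, by simp [info],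
        Or.inl (Or.inr (Or.inr ?_))⟩
      simpa using ⟨by linarith, hx, hε.1⟩

lemma limsup_errorProb_le_of_confusable (ha₁ : 0 < a₁) (ha₂ : 0 < a₂) (alg : Algorithm 2)
    (hcons : Consistent alg (gaussianClass a₁ a₂) τ) (ν : Bandit 2)
    (hν : ∀ k, ν k ∈ gaussianClass a₁ a₂) {i j : Fin 2} (hij : i ≠ j)
    (hi : Beats τ (attr (ν i)) (attr (ν j))) {I : ℝ}
    (h : Confusable a₁ a₂ τ (attr (ν i)) (attr (ν j)) I) :
    limsup (fun T : ℕ => ((-(1 / (T : ℝ)) : ℝ) : EReal) *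
        ENNReal.log (errorProb alg τ ν T)) atTop ≤ (I : EReal) := by
  obtain ⟨g, hg, rfl, h⟩ := h
  refine ereal_le_of_eventually hg ?_
  filter_upwards [h] with ε ⟨x, y, hx, hy, hxy⟩
  exact limsup_errorProb_le_of_attr ha₁ ha₂ alg hcons ν hν hij x y hx hy hi hxy

end ConstrainedBandit

theorem theorem1 (a₁ a₂ : ℝ) (ha₁ : 0 < a₁) (ha₂ : 0 < a₂) (τ : ℝ)
    (alg : ConstrainedBandit.Algorithm 2)
    (hcons : ConstrainedBandit.Consistent alg (ConstrainedBandit.gaussianClass a₁ a₂) τ)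
    (ν : ConstrainedBandit.Bandit 2) (hν : ∀ k, ν k ∈ ConstrainedBandit.gaussianClass a₁ a₂)
    (i j : Fin 2) (hij : i ≠ j) (hi : ConstrainedBandit.IsTheOptimalArm τ ν i) :
    limsup (fun T : ℕ => ((-(1 / (T : ℝ)) : ℝ) : EReal) *
        ENNReal.log (ConstrainedBandit.errorProb alg τ ν T)) atTop ≤
      ((ConstrainedBandit.gapΔ a₁ a₂ τ (ConstrainedBandit.attr (ν i))
        (ConstrainedBandit.attr (ν j)) ^ 2 : ℝ) : EReal) := by
  have hb := (ConstrainedBandit.isTheOptimalArm_iff hij).1 hi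
  rw [ConstrainedBandit.gapΔ]
  rcases min_choice (√a₂ * |τ - ConstrainedBandit.attr (ν i) 1|)
    (ConstrainedBandit.gapδ a₁ a₂ τ (ConstrainedBandit.attr (ν i))
      (ConstrainedBandit.attr (ν j))) with h | h <;> rw [h]
  · rw [mul_pow, Real.sq_sqrt ha₂.le, sq_abs]
    exact ConstrainedBandit.limsup_errorProb_le_of_confusable ha₁ ha₂ alg hcons ν hν hij hb
      (ConstrainedBandit.confusable_feasibility ha₂ hb)
  · exact ConstrainedBandit.limsup_errorProb_le_of_confusable ha₁ ha₂ alg hcons ν hν hij hb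
      (ConstrainedBandit.confusable_gapδ ha₁ ha₂ hb)
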